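/- For each integer $t \ge 0$ let \begin{align*} T_t(x) = {} & x^{8t+27} + x^{8t+26} + x^{8t+25} + x^{8t+22} + x^{8t+20} + x^{8t+18} + x^{8t+17} - x^{8t+16} - x^{8t+15} \\ & + 2x^{6t+15} - x^{4t+26} - x^{4t+25} + x^{4t+23} - x^{4t+21} - x^{4t+20} + x^{4t+19} - x^{4t+18} - x^{4t+17} \\ & + 3x^{4t+14} - 3x^{4t+13} + x^{4t+10} + x^{4t+9} - x^{4t+8} + x^{4t+7} + x^{4t+6} - x^{4t+4} + x^{4t+2} + x^{4t+1} \\ & - 2x^{2t+12} + x^{12} + x^{11} - x^{10} - x^{9} - x^{7} - x^{5} - x^{2} - x - 1, \end{align*} and for each integer $b \ge 1$ let $\Phi_b(x) = \prod_{\zeta} (x - \zeta)$ be the $b$-th cyclotomic polynomial, where $\zeta$ ranges over the primitive $b$-th roots of unity. Then for every integer $t \ge 0$ and every integer $b \ge 3$, the polynomial $\Phi_b(x)$ does not divide $T_t(x)$ in $\mathbb{Q}[x]$. -/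

import Mathlib

open Polynomial


/-- The polynomial `T_t(x)`. It has integer coefficients; divisibility is taken in `ℚ[X]`. -/
noncomputable def polyT (t : ℕ) : ℚ[X] :=
  X ^ (8 * t + 27) + X ^ (8 * t + 26) + X ^ (8 * t + 25) + X ^ (8 * t + 22)
    + X ^ (8 * t + 20) + X ^ (8 * t + 18) + X ^ (8 * t + 17)
    - X ^ (8 * t + 16) - X ^ (8 * t + 15)
    + 2 * X ^ (6 * t + 15)
    - X ^ (4 * t + 26) - X ^ (4 * t + 25) + X ^ (4 * t + 23)
    - X ^ (4 * t + 21) - X ^ (4 * t + 20) + X ^ (4 * t + 19)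
    - X ^ (4 * t + 18) - X ^ (4 * t + 17)
    + 3 * X ^ (4 * t + 14) - 3 * X ^ (4 * t + 13)
    + X ^ (4 * t + 10) + X ^ (4 * t + 9) - X ^ (4 * t + 8)
    + X ^ (4 * t + 7) + X ^ (4 * t + 6) - X ^ (4 * t + 4)
    + X ^ (4 * t + 2) + X ^ (4 * t + 1)
    - 2 * X ^ (2 * t + 12)
    + X ^ 12 + X ^ 11 - X ^ 10 - X ^ 9 - X ^ 7 - X ^ 5 - X ^ 2 - X - 1

/-! Write `T_t = A Y⁴ + 2X¹⁵Y³ + B Y² - 2X¹²Y + C` with `Y = X^(2t)`. Given two relations modulo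
`Φ_b`, eliminating `Y` leaves a polynomial independent of `t`. Modulo 2 the odd powers of `Y`
vanish, so the elimination is done over `ZMod 2`.

If `b` is odd and `Φ_b ∣ f`, then also `Φ_b ∣ f(X²)`, and `(f² - f(X²))/2` is a second relation
(`cyclotomic_dvd_half_sq_sub_expand`). If `b = 2m` with `m` odd, `X ↦ -X` leads back to `m`. If `4 ∣
b`, then `Φ_b(X) = Φ_{b/2}(X²)`, so the even and odd parts of `T_t` are the two relations.

Each eliminant is a nonzero polynomial, so its degree bounds the totient, hence `b`
(`totient_bound`). Testing the remaining odd parts over `ZMod 2` leaves 13 values of `b`. These are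
excluded over `ℤ` by evaluating at 4, where only `t` modulo `b` matters
(`not_cyclotomic_dvd_intPolyT`). -/

/-! ### Divisibility by cyclotomic polynomials -/

/-- This lets both finite checks use only `X ^ e - 1`, without ever computing a cyclotomic
polynomial. -/
theorem X_pow_sub_one_dvd_cyclotomic_mul_prod {m : ℕ} (hm : 0 < m) (R : Type*) [CommRing R] :
    (X ^ m - 1 : R[X]) ∣ cyclotomic m R * ∏ e ∈ m.properDivisors, (X ^ e - 1) := by
  have h : (∏ e ∈ m.properDivisors, cyclotomic e R) ∣ ∏ e ∈ m.properDivisors, (X ^ e - 1) :=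
    Finset.prod_dvd_prod_of_dvd _ _ fun e _ => cyclotomic.dvd_X_pow_sub_one e R
  rw [← prod_cyclotomic_eq_X_pow_sub_one hm, ← Nat.cons_self_properDivisors hm.ne',
    Finset.prod_cons]
  exact mul_dvd_mul_left _ h

/-- Squaring permutes the primitive `m`-th roots of unity when `m` is odd. -/
theorem cyclotomic_dvd_expand_two {m : ℕ} (hm : ¬ 2 ∣ m) {f : ℤ[X]} (h : cyclotomic m ℤ ∣ f) :
    cyclotomic m ℤ ∣ expand ℤ 2 f := by
  obtain ⟨q, rfl⟩ := h
  rw [map_mul, cyclotomic_expand_eq_cyclotomic_mul Nat.prime_two hm, mul_assoc]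
  exact (dvd_mul_right _ _).mul_left _

/-- The constant 2 is prime in `ℤ[X]` and does not divide a monic polynomial. -/
theorem cyclotomic_dvd_of_dvd_two_mul {m : ℕ} {q : ℤ[X]} (h : cyclotomic m ℤ ∣ 2 * q) :
    cyclotomic m ℤ ∣ q := by
  obtain ⟨g, hg⟩ := h
  have hp : Prime (C 2 : ℤ[X]) := prime_C_iff.2 Int.prime_two
  have h2 : (C 2 : ℤ[X]) ∣ cyclotomic m ℤ * g := ⟨q, by rw [← hg]; simp⟩
  rcases hp.dvd_or_dvd h2 with h3 | ⟨k, rfl⟩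
  · have := (C_dvd_iff_dvd_coeff _ _).1 h3 (cyclotomic m ℤ).natDegree
    rw [coeff_natDegree, (cyclotomic.monic m ℤ).leadingCoeff] at this
    norm_num at this
  · refine ⟨k, mul_left_cancel₀ hp.ne_zero ?_⟩
    rw [show (C 2 : ℤ[X]) * q = 2 * q by simp, hg]; ring

theorem cyclotomic_dvd_half_sq_sub_expand {m : ℕ} (hm : ¬ 2 ∣ m) {f q : ℤ[X]}
    (hf : f ^ 2 = expand ℤ 2 f + 2 * q) (h : cyclotomic m ℤ ∣ f) : cyclotomic m ℤ ∣ q :=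
  cyclotomic_dvd_of_dvd_two_mul <| by
    rw [← sub_eq_of_eq_add' hf]
    exact dvd_sub (dvd_pow h two_ne_zero) (cyclotomic_dvd_expand_two hm h)

theorem cyclotomic_dvd_iff_aeval_eq_zero {n : ℕ} (hn : 0 < n) {ζ : ℂ} (hζ : IsPrimitiveRoot ζ n)
    (f : ℤ[X]) : cyclotomic n ℤ ∣ f ↔ aeval ζ f = 0 := by
  rw [cyclotomic_eq_minpoly hζ hn]
  exact (minpoly.isIntegrallyClosed_dvd_iff (hζ.isIntegral hn) f).symm

theorem cyclotomic_dvd_comp_neg_X {m : ℕ} (hm : ¬ 2 ∣ m) {f : ℤ[X]}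
    (h : cyclotomic (2 * m) ℤ ∣ f) : cyclotomic m ℤ ∣ f.comp (-X) := by
  have h0 : 0 < m := Nat.pos_of_ne_zero (by rintro rfl; simp at hm)
  have hζ := Complex.isPrimitiveRoot_exp m h0.ne'
  set ζ := Complex.exp (2 * Real.pi * Complex.I / m)
  -- The orders 2 of `-1` and `m` of `ζ` are coprime, so they multiply.
  have hn : IsPrimitiveRoot (-ζ) (2 * m) := by
    have hc : Nat.Coprime (orderOf (-1 : ℂ)) (orderOf ζ) := by
      rw [← hζ.eq_orderOf, ← (IsPrimitiveRoot.neg_one 0 (by norm_num)).eq_orderOf]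
      exact (Nat.Prime.coprime_iff_not_dvd Nat.prime_two).2 hm
    have := (Commute.all (-1 : ℂ) ζ).orderOf_mul_eq_mul_orderOf_of_coprime hc
    rw [← hζ.eq_orderOf, ← (IsPrimitiveRoot.neg_one 0 (by norm_num)).eq_orderOf, neg_one_mul] at this
    rw [← this]
    exact IsPrimitiveRoot.orderOf _
  rw [cyclotomic_dvd_iff_aeval_eq_zero (by omega) hn] at h
  rw [cyclotomic_dvd_iff_aeval_eq_zero h0 hζ, aeval_comp]
  simpa using h

theorem contract_two_X_mul_expand (g : ℤ[X]) : contract 2 (X * expand ℤ 2 g) = 0 := by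
  rw [contract_mul_expand two_ne_zero]
  have : contract 2 (X : ℤ[X]) = 0 := by
    ext n
    rw [coeff_contract two_ne_zero, coeff_X, if_neg (by omega), coeff_zero]
  rw [this, zero_mul]

theorem dvd_of_expand_dvd_expand_add {g E O : ℤ[X]} (hg : IsCoprime g X)
    (h : expand ℤ 2 g ∣ expand ℤ 2 E + X * expand ℤ 2 O) : g ∣ E ∧ g ∣ O := by
  have key : ∀ {E O : ℤ[X]}, expand ℤ 2 g ∣ expand ℤ 2 E + X * expand ℤ 2 O → g ∣ E := by
    rintro E O ⟨k, hk⟩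
    have := congrArg (contract 2) hk
    rw [contract_add two_ne_zero, contract_expand 2 two_ne_zero, contract_two_X_mul_expand, add_zero,
      mul_comm, contract_mul_expand two_ne_zero] at this
    exact ⟨_, this.trans (mul_comm _ _)⟩
  -- Multiplying by `X` makes `X * O` the even part and `E` the odd part.
  refine ⟨key h, hg.dvd_of_dvd_mul_left (key (O := E) ?_)⟩
  have := h.mul_left X
  rw [map_mul, expand_X]
  convert this using 1
  ring

theorem isCoprime_cyclotomic_X {n : ℕ} (hn : 1 < n) : IsCoprime (cyclotomic n ℤ) X :=
  ⟨1, -(cyclotomic n ℤ).divX, by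
    have := divX_mul_X_add (cyclotomic n ℤ)
    rw [cyclotomic_coeff_zero ℤ hn, C_1] at this
    linear_combination -this⟩

theorem cyclotomic_dvd_of_two_dvd {n : ℕ} (h0 : 0 < n) (hn : 2 ∣ n) {E O : ℤ[X]}
    (h : cyclotomic (n * 2) ℤ ∣ expand ℤ 2 E + X * expand ℤ 2 O) :
    cyclotomic n ℤ ∣ E ∧ cyclotomic n ℤ ∣ O := by
  rw [← cyclotomic_expand_eq_cyclotomic Nat.prime_two hn] at h
  exact dvd_of_expand_dvd_expand_add (isCoprime_cyclotomic_X (by omega)) h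

/-! ### A lower bound for the totient of odd numbers -/

/-- Both sides are multiplicative, and `p³ ≤ (p - 1)⁴` for every prime `p ≥ 5`. Only `p = 3` fails,
at the cost of a single factor 27/16. -/
theorem totient_bound {m : ℕ} (hm : ¬ 2 ∣ m) :
    (¬ 3 ∣ m → m ^ 3 ≤ m.totient ^ 4) ∧ 16 * m ^ 3 ≤ 27 * m.totient ^ 4 := by
  induction m using Nat.recOnPosPrimePosCoprime with
  | zero => simp at hm
  | one => simp
  | prime_pow p n hp hn =>
    obtain ⟨k, rfl⟩ := Nat.exists_eq_add_of_lt hn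
    have h2 : p ≠ 2 := by rintro rfl; exact hm (dvd_pow_self 2 hn.ne')
    have h3 := hp.two_le
    have hk : 1 ≤ p ^ k := Nat.one_le_pow _ _ hp.pos
    have hk' : (p ^ k) ^ 3 ≤ (p ^ k) ^ 4 := Nat.pow_le_pow_right hk (by norm_num)
    obtain ⟨r, rfl⟩ : ∃ r, p = r + 3 := ⟨p - 3, by omega⟩
    rw [zero_add, Nat.totient_prime_pow_succ hp]
    simp only [pow_succ _ k, mul_pow]
    have e : r + 3 - 1 = r + 2 := rfl
    rw [e]
    by_cases hr : r = 0
    · subst hr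
      refine ⟨fun h => absurd (dvd_mul_left _ _) h, ?_⟩
      norm_num
      norm_num at hk'
      omega
    · have h5 : (r + 3) ^ 3 ≤ (r + 2) ^ 4 := by
        have : 1 ≤ r := Nat.one_le_iff_ne_zero.2 hr
        nlinarith [sq_nonneg r, pow_pos (show 0 < r from this) 3]
      have h6 := Nat.mul_le_mul hk' h5
      exact ⟨fun _ => h6, by omega⟩
  | coprime a b ha hb hab iha ihb =>
    have h2a : ¬ 2 ∣ a := fun h => hm (h.mul_right _)
    have h2b : ¬ 2 ∣ b := fun h => hm (h.mul_left _)
    obtain ⟨a1, a2⟩ := iha h2a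
    obtain ⟨b1, b2⟩ := ihb h2b
    rw [Nat.totient_mul hab, mul_pow, mul_pow]
    refine ⟨fun h => Nat.mul_le_mul (a1 fun h' => h (h'.mul_right _))
      (b1 fun h' => h (h'.mul_left _)), ?_⟩
    by_cases h3 : 3 ∣ a
    · have : ¬ 3 ∣ b := fun h => by
        have := Nat.dvd_gcd h3 h
        rw [hab] at this
        norm_num at this
      calc _ = (16 * a ^ 3) * b ^ 3 := by ring
        _ ≤ (27 * a.totient ^ 4) * b.totient ^ 4 := Nat.mul_le_mul a2 (b1 this)
        _ = _ := by ring
    · calc _ = a ^ 3 * (16 * b ^ 3) := by ring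
        _ ≤ a.totient ^ 4 * (27 * b.totient ^ 4) := Nat.mul_le_mul (a1 h3) b2
        _ = _ := by ring

/-! ### Binary arithmetic in `(ZMod 2)[X]` and a non-divisibility test -/

/-- The polynomial over `ZMod 2` whose coefficients are the binary digits of `n`. -/
noncomputable def ofBits (n : ℕ) : (ZMod 2)[X] :=
  ∑ i ∈ Finset.range n, if n.testBit i then X ^ i else 0

theorem coeff_ofBits (n i : ℕ) : (ofBits n).coeff i = if n.testBit i then 1 else 0 := by
  have h : ∀ j, ((if n.testBit j then X ^ j else 0 : (ZMod 2)[X])).coeff i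
      = if i = j then (if n.testBit i then 1 else 0) else 0 := by
    intro j
    by_cases hij : i = j
    · subst hij
      rw [if_pos rfl]
      split_ifs <;> simp
    · split_ifs <;> simp [coeff_X_pow, hij]
  rw [ofBits, finsetSum_coeff, Finset.sum_congr rfl fun j _ => h j, Finset.sum_ite_eq]
  by_cases hi : i < n
  · simp [hi]
  · have : n.testBit i = false :=
      Nat.testBit_lt_two_pow ((not_lt.1 hi).trans_lt Nat.lt_two_pow_self)
    simp [this]

theorem ofBits_zero : ofBits 0 = 0 := by simp [ofBits]

theorem ofBits_xor (a b : ℕ) : ofBits (a ^^^ b) = ofBits a + ofBits b := by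
  ext i
  rw [coeff_add, coeff_ofBits, coeff_ofBits, coeff_ofBits, Nat.testBit_xor]
  cases a.testBit i <;> cases b.testBit i <;> simp [CharTwo.add_self_eq_zero]

theorem ofBits_shiftLeft (a k : ℕ) : ofBits (a <<< k) = ofBits a * X ^ k := by
  ext i
  rw [coeff_mul_X_pow', coeff_ofBits, Nat.testBit_shiftLeft, coeff_ofBits]
  by_cases h : k ≤ i <;> simp [h]

theorem ofBits_one : ofBits 1 = 1 := by simp [ofBits]

theorem ofBits_mod_add_shiftRight (a k : ℕ) :
    ofBits a = ofBits (a % 2 ^ k) + ofBits (a >>> k) * X ^ k := by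
  rw [← ofBits_shiftLeft, ← ofBits_xor]
  congr 1
  refine Nat.eq_of_testBit_eq fun i => ?_
  rw [Nat.testBit_xor, Nat.testBit_mod_two_pow, Nat.testBit_shiftLeft, Nat.testBit_shiftRight]
  by_cases h : i < k
  · simp [h, not_le.2 h]
  · simp [h, not_lt.1 h, Nat.add_sub_cancel' (not_lt.1 h)]

theorem ofBits_eq_zero_iff {a : ℕ} : ofBits a = 0 ↔ a = 0 := by
  refine ⟨fun h => Nat.eq_of_testBit_eq fun i => ?_, by rintro rfl; exact ofBits_zero⟩
  have := congrArg (fun f => f.coeff i) h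
  simp only [coeff_ofBits, coeff_zero] at this
  rw [Nat.zero_testBit]
  by_contra hc
  simp [hc] at this

theorem degree_ofBits_lt {a k : ℕ} (h : a < 2 ^ k) : (ofBits a).degree < k := by
  rw [degree_lt_iff_coeff_zero]
  intro i hi
  rw [coeff_ofBits, Nat.testBit_lt_two_pow (h.trans_le (Nat.pow_le_pow_right two_pos hi))]
  simp

/-- Carry-less product of `a` with the `k` lowest binary digits of `b`. -/
def clmulAux : ℕ → ℕ → ℕ → ℕ
  | 0, _, _ => 0
  | k + 1, a, b => (if b % 2 = 1 then a else 0) ^^^ (clmulAux k a (b / 2)) <<< 1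

/-- Carry-less product, i.e. the product of polynomials over `ZMod 2` in binary digits. -/
def clmul (a b : ℕ) : ℕ := clmulAux (b.log2 + 1) a b

theorem ofBits_clmulAux (k a b : ℕ) (h : b < 2 ^ k) :
    ofBits (clmulAux k a b) = ofBits a * ofBits b := by
  induction k generalizing b with
  | zero =>
    obtain rfl : b = 0 := by simpa using h
    simp [clmulAux, ofBits_zero]
  | succ k ih =>
    have hb : ofBits b = ofBits (b % 2) + ofBits (b / 2) * X := by
      simpa [Nat.shiftRight_one] using ofBits_mod_add_shiftRight b 1
    rw [clmulAux, ofBits_xor, ofBits_shiftLeft, ih _ (by omega), hb]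
    rcases Nat.mod_two_eq_zero_or_one b with h2 | h2 <;> simp [h2, ofBits_zero, ofBits_one] <;> ring

theorem ofBits_clmul (a b : ℕ) : ofBits (clmul a b) = ofBits a * ofBits b :=
  ofBits_clmulAux _ _ _ Nat.lt_log2_self

/-- Reduction modulo `X ^ m - 1` in binary digits, with at most `k` steps. -/
def cycRed (m : ℕ) : ℕ → ℕ → ℕ
  | 0, f => f
  | k + 1, f => if f < 2 ^ m then f else cycRed m k (f % 2 ^ m ^^^ f >>> m)

/-- Multiplies `f` by `X ^ e - 1` for all divisors `e ≤ k` of `m`, modulo `X ^ m - 1`. -/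
def mulDivisors (m : ℕ) : ℕ → ℕ → ℕ
  | 0, f => f
  | k + 1, f => mulDivisors m k
      (if m % (k + 1) = 0 then cycRed m 200 (f ^^^ f <<< (k + 1)) else f)

/-- A sufficient test for the `m`-th cyclotomic polynomial not to divide `f` over `ZMod 2`. -/
def notDvdTest (f m : ℕ) : Bool :=
  let g := mulDivisors m (m / 2) (cycRed m 200 f)
  g != 0 && g.log2 < m

/-- The congruence holds for any number of steps, so soundness does not depend on the bound 200;
`notDvdTest` checks the final degree itself. -/
theorem dvd_ofBits_cycRed_sub (m k f : ℕ) :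
    (X ^ m - 1 : (ZMod 2)[X]) ∣ ofBits (cycRed m k f) - ofBits f := by
  induction k generalizing f with
  | zero => simp [cycRed]
  | succ k ih =>
    rw [cycRed]
    split_ifs with h
    · simp
    · have h1 := ih (f % 2 ^ m ^^^ f >>> m)
      have h2 : ofBits (f % 2 ^ m ^^^ f >>> m) - ofBits f = (X ^ m - 1) * -ofBits (f >>> m) := by
        rw [ofBits_mod_add_shiftRight f m, ofBits_xor]; ring
      have := dvd_add h1 ⟨_, h2⟩
      simpa using this

theorem dvd_ofBits_mulDivisors {m : ℕ} (k f : ℕ) :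
    (X ^ m - 1 : (ZMod 2)[X]) ∣ ofBits (mulDivisors m k f)
      - ofBits f * ∏ e ∈ (Finset.range k).filter (fun e => m % (e + 1) = 0), (X ^ (e + 1) - 1) := by
  induction k generalizing f with
  | zero => simp [mulDivisors]
  | succ k ih =>
    rw [mulDivisors, Finset.range_add_one, Finset.filter_insert]
    split_ifs with h
    · rw [Finset.prod_insert (by simp)]
      have h1 := ih (cycRed m 200 (f ^^^ f <<< (k + 1)))
      have h2 := dvd_ofBits_cycRed_sub m 200 (f ^^^ f <<< (k + 1))
      have h3 : ofBits (f ^^^ f <<< (k + 1)) = ofBits f * (X ^ (k + 1) - 1) := by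
        rw [ofBits_xor, ofBits_shiftLeft, CharTwo.sub_eq_add]; ring
      rw [h3] at h2
      have := dvd_add h1 (h2.mul_right
        (∏ e ∈ (Finset.range k).filter (fun e => m % (e + 1) = 0), (X ^ (e + 1) - 1)))
      convert this using 1
      ring
    · exact ih f

theorem prod_properDivisors_eq {m : ℕ} (hm : 0 < m) {R : Type*} [CommRing R] :
    ∏ e ∈ m.properDivisors, (X ^ e - 1 : R[X])
      = ∏ e ∈ (Finset.range (m / 2)).filter (fun e => m % (e + 1) = 0), (X ^ (e + 1) - 1) := by
  symm
  refine Finset.prod_bij (fun e _ => e + 1) ?_ ?_ ?_ ?_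
  · intro e he
    simp only [Finset.mem_filter, Finset.mem_range] at he
    exact Nat.mem_properDivisors.2 ⟨Nat.dvd_of_mod_eq_zero he.2, by omega⟩
  · intro a _ b _ h
    simpa using h
  · intro e he
    obtain ⟨⟨c, rfl⟩, h2⟩ := Nat.mem_properDivisors.1 he
    have he0 : 0 < e := Nat.pos_of_ne_zero (by rintro rfl; simp at hm)
    have hc : 2 ≤ c := by
      by_contra hc
      interval_cases c <;> simp at hm h2
    have : e ≤ e * c / 2 := by
      rw [Nat.le_div_iff_mul_le two_pos]; exact Nat.mul_le_mul_left _ hc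
    refine ⟨e - 1, ?_, by omega⟩
    simp only [Finset.mem_filter, Finset.mem_range, Nat.sub_add_cancel he0]
    exact ⟨by omega, Nat.mul_mod_right _ _⟩
  · intros; rfl

/-- If `Φ_m ∣ f`, then `X ^ m - 1` divides `f ∏ (X ^ e - 1)` over the proper divisors `e` of `m`,
which a nonzero residue of degree below `m` refutes. -/
theorem not_cyclotomic_dvd_ofBits {m f : ℕ} (hm : 0 < m) (h : notDvdTest f m = true) :
    ¬ cyclotomic m (ZMod 2) ∣ ofBits f := by
  intro hd
  have h1 := (X_pow_sub_one_dvd_cyclotomic_mul_prod hm (ZMod 2)).trans (mul_dvd_mul_right hd _)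
  have h2 := dvd_ofBits_mulDivisors (m := m) (m / 2) (cycRed m 200 f)
  have h3 := (dvd_ofBits_cycRed_sub m 200 f).mul_right (∏ e ∈ m.properDivisors, (X ^ e - 1))
  rw [← prod_properDivisors_eq hm] at h2
  have h4 := dvd_add (dvd_add h2 h3) h1
  have h5 : (X ^ m - 1 : (ZMod 2)[X]) ∣ ofBits (mulDivisors m (m / 2) (cycRed m 200 f)) := by
    convert h4 using 1
    ring
  simp only [notDvdTest, Bool.and_eq_true, bne_iff_ne, decide_eq_true_eq] at h
  obtain ⟨h6, h7⟩ := h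
  refine h6 (ofBits_eq_zero_iff.1 (eq_zero_of_dvd_of_degree_lt h5 ?_))
  rw [← C_1, degree_X_pow_sub_C hm]
  exact degree_ofBits_lt ((Nat.log2_lt h6).1 h7)

/-! ### Signed sums and their half-differences modulo 2 -/

/-- The signed monomial `X ^ e` or `-X ^ e`; the Boolean is `true` for the minus sign. -/
noncomputable def signedMonomial (p : Bool × ℕ) : ℤ[X] := if p.1 then -X ^ p.2 else X ^ p.2

/-- A sum of signed monomials. -/
noncomputable def signedSum (L : List (Bool × ℕ)) : ℤ[X] := (L.map signedMonomial).sum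

/-- Binary digits of the reduction modulo 2 of `signedSum L`. -/
def sumBits (L : List (Bool × ℕ)) : ℕ := L.foldr (fun p n => 1 <<< p.2 ^^^ n) 0

/-- Binary digits of the reduction modulo 2 of `(f ^ 2 - f(X ^ 2)) / 2` for `f = signedSum L`. -/
def halfBits : List (Bool × ℕ) → ℕ
  | [] => 0
  | p :: L => (sumBits L <<< p.2 ^^^ halfBits L) ^^^ (if p.1 then 1 <<< (2 * p.2) else 0)

theorem signedSum_cons (p : Bool × ℕ) (L) : signedSum (p :: L) = signedMonomial p + signedSum L := by
  simp [signedSum]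

theorem sumBits_cons (p : Bool × ℕ) (L) : sumBits (p :: L) = 1 <<< p.2 ^^^ sumBits L := rfl

theorem map_signedMonomial (p : Bool × ℕ) :
    (signedMonomial p).map (Int.castRingHom (ZMod 2)) = X ^ p.2 := by
  rw [signedMonomial]
  split_ifs <;> simp [CharTwo.neg_eq]

theorem map_signedSum (L : List (Bool × ℕ)) :
    (signedSum L).map (Int.castRingHom (ZMod 2)) = ofBits (sumBits L) := by
  induction L with
  | nil => simp [signedSum, sumBits, ofBits_zero]
  | cons p L ih =>
    rw [signedSum_cons, Polynomial.map_add, ih, map_signedMonomial, sumBits_cons,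
      ofBits_xor, ofBits_shiftLeft, ofBits_one, one_mul]

theorem exists_half (L : List (Bool × ℕ)) : ∃ W : ℤ[X],
    signedSum L ^ 2 = expand ℤ 2 (signedSum L) + 2 * W ∧
      W.map (Int.castRingHom (ZMod 2)) = ofBits (halfBits L) := by
  induction L with
  | nil => exact ⟨0, by simp [signedSum], by simp [halfBits, ofBits_zero]⟩
  | cons p L ih =>
    obtain ⟨W, h1, h2⟩ := ih
    obtain ⟨s, e⟩ := p
    -- Besides the cross term, a monomial `p` contributes `(p² - p(X²))/2`, which is 0 for the plus
    -- sign and `X ^ (2 * e)` for the minus sign.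
    refine ⟨signedMonomial (s, e) * signedSum L + W + (if s then X ^ (2 * e) else 0), ?_, ?_⟩
    · rw [signedSum_cons, map_add, add_sq, h1]
      cases s <;> simp [signedMonomial] <;> ring
    · rw [halfBits, ofBits_xor, ofBits_xor, ofBits_shiftLeft, ← map_signedSum, ← h2]
      cases s <;> simp [ofBits_zero, ofBits_shiftLeft, ofBits_one, map_signedMonomial] <;> ring

/-! ### Elimination -/

/-- Elimination of `y` from a quadratic and a quartic. -/
theorem dvd_elimination_quartic {R : Type*} [CommRing R] {d a b c q₀ q₁ q₂ q₃ q₄ y r₃ r₂ s₂ s₁ α β : R}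
    (hP : d ∣ a * y ^ 2 + b * y + c)
    (hQ : d ∣ q₄ * y ^ 4 + q₃ * y ^ 3 + q₂ * y ^ 2 + q₁ * y + q₀)
    (h₃ : r₃ = a * q₃ - b * q₄) (h₂ : r₂ = a * q₂ - c * q₄)
    (k₂ : s₂ = a * r₂ - b * r₃) (k₁ : s₁ = a * (a * q₁) - c * r₃)
    (hα : α = a * s₁ - b * s₂) (hβ : β = a * (a * (a * q₀)) - c * s₂) :
    d ∣ (a * (β * β) - b * (α * β)) + c * (α * α) := by
  obtain ⟨p, hp⟩ := hP
  obtain ⟨q, hq⟩ := hQ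
  refine ⟨α ^ 2 * p
    + (a * (β - α * y) - b * α) * (a ^ 3 * q - (a ^ 2 * q₄ * y ^ 2 + a * r₃ * y + s₂) * p), ?_⟩
  -- Pseudo-division of the quartic by the quadratic leaves `α * y + β`; the conclusion is the
  -- resultant of this with the quadratic.
  have h : α * y + β = d * (a ^ 3 * q - (a ^ 2 * q₄ * y ^ 2 + a * r₃ * y + s₂) * p) := by
    have : α * y + β = a ^ 3 * (q₄ * y ^ 4 + q₃ * y ^ 3 + q₂ * y ^ 2 + q₁ * y + q₀)
        - (a ^ 2 * q₄ * y ^ 2 + a * r₃ * y + s₂) * (a * y ^ 2 + b * y + c) := by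
      rw [hα, hβ, k₁, k₂, h₂, h₃]; ring
    rw [this, hp, hq]; ring
  linear_combination α ^ 2 * hp + (a * (β - α * y) - b * α) * h

/-- Two combinations of the quadratics are linear in `y`; their determinant is the resultant. -/
theorem dvd_elimination_quadratic {R : Type*} [CommRing R] {d a b c a' b' c' y : R}
    (h : d ∣ a * y ^ 2 + b * y + c) (h' : d ∣ a' * y ^ 2 + b' * y + c') :
    d ∣ (a * c' - c * a') * (a * c' - c * a') - (a * b' - b * a') * (b * c' - c * b') := by
  obtain ⟨p, hp⟩ := h
  obtain ⟨q, hq⟩ := h'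
  have h1 : (a * b' - b * a') * y + (a * c' - c * a') = d * (a * q - a' * p) := by
    linear_combination a * hq - a' * hp
  have h2 : (a * c' - c * a') * y + (b * c' - c * b') = d * ((b + a * y) * q - (b' + a' * y) * p) := by
    linear_combination (b + a * y) * hq - (b' + a' * y) * hp
  exact ⟨(a * c' - c * a') * (a * q - a' * p)
    - (a * b' - b * a') * ((b + a * y) * q - (b' + a' * y) * p), by
    linear_combination (a * c' - c * a') * h1 - (a * b' - b * a') * h2⟩

/-- `dvd_elimination_quartic` in binary digits. -/
def elimQuartic (a b c q₀ q₁ q₂ q₃ q₄ : ℕ) : ℕ :=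
  let r₃ := clmul a q₃ ^^^ clmul b q₄
  let r₂ := clmul a q₂ ^^^ clmul c q₄
  let s₂ := clmul a r₂ ^^^ clmul b r₃
  let s₁ := clmul a (clmul a q₁) ^^^ clmul c r₃
  let α := clmul a s₁ ^^^ clmul b s₂
  let β := clmul a (clmul a (clmul a q₀)) ^^^ clmul c s₂
  (clmul a (clmul β β) ^^^ clmul b (clmul α β)) ^^^ clmul c (clmul α α)

/-- `dvd_elimination_quadratic` in binary digits. -/
def elimQuadratic (a b c a' b' c' : ℕ) : ℕ :=
  let u := clmul a c' ^^^ clmul c a'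
  clmul u u ^^^ clmul (clmul a b' ^^^ clmul b a') (clmul b c' ^^^ clmul c b')

theorem dvd_ofBits_elimQuartic {d y : (ZMod 2)[X]} {a b c q₀ q₁ q₂ q₃ q₄ : ℕ}
    (hP : d ∣ ofBits a * y ^ 2 + ofBits b * y + ofBits c)
    (hQ : d ∣ ofBits q₄ * y ^ 4 + ofBits q₃ * y ^ 3 + ofBits q₂ * y ^ 2 + ofBits q₁ * y + ofBits q₀) :
    d ∣ ofBits (elimQuartic a b c q₀ q₁ q₂ q₃ q₄) := by
  have := dvd_elimination_quartic hP hQ rfl rfl rfl rfl rfl rfl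
  simpa only [elimQuartic, ofBits_xor, ofBits_clmul, CharTwo.sub_eq_add] using this

theorem dvd_ofBits_elimQuadratic {d y : (ZMod 2)[X]} {a b c a' b' c' : ℕ}
    (h : d ∣ ofBits a * y ^ 2 + ofBits b * y + ofBits c)
    (h' : d ∣ ofBits a' * y ^ 2 + ofBits b' * y + ofBits c') :
    d ∣ ofBits (elimQuadratic a b c a' b' c') := by
  have := dvd_elimination_quadratic h h'
  simpa only [elimQuadratic, ofBits_xor, ofBits_clmul, CharTwo.sub_eq_add] using this

/-- Binary digits of a polynomial over `ZMod 2` divisible by every `cyclotomic m` with `m` odd that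
divides `A Y ^ 4 ± 2 X ^ 15 Y ^ 3 + B Y ^ 2 - 2 X ^ 12 Y + C` for `Y` a power of `X ^ 2`. -/
def oddBits (LA LB LC : List (Bool × ℕ)) : ℕ :=
  elimQuartic (sumBits LA) (sumBits LB) (sumBits LC) (halfBits LC)
    (clmul (sumBits LB) (sumBits LC) ^^^ 1 <<< 24)
    (halfBits LB ^^^ clmul (sumBits LA) (sumBits LC))
    (clmul (sumBits LA) (sumBits LB) ^^^ 1 <<< 30) (halfBits LA)

theorem map_cyclotomic_dvd {m : ℕ} {f : ℤ[X]} (h : cyclotomic m ℤ ∣ f) :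
    cyclotomic m (ZMod 2) ∣ f.map (Int.castRingHom (ZMod 2)) := by
  obtain ⟨q, rfl⟩ := h
  rw [Polynomial.map_mul, map_cyclotomic]
  exact dvd_mul_right _ _

theorem cyclotomic_dvd_oddBits {m t : ℕ} (hm : ¬ 2 ∣ m) (LA LB LC : List (Bool × ℕ)) {ε : ℤ[X]}
    (hε : ε = 1 ∨ ε = -1)
    (h : cyclotomic m ℤ ∣ signedSum LA * X ^ (8 * t) + ε * 2 * X ^ (6 * t + 15)
      + signedSum LB * X ^ (4 * t) - 2 * X ^ (2 * t + 12) + signedSum LC) :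
    cyclotomic m (ZMod 2) ∣ ofBits (oddBits LA LB LC) := by
  obtain ⟨WA, hA, hA'⟩ := exists_half LA
  obtain ⟨WB, hB, hB'⟩ := exists_half LB
  obtain ⟨WC, hC, hC'⟩ := exists_half LC
  set A := signedSum LA with defA
  set B := signedSum LB with defB
  set C := signedSum LC with defC
  have hε2 : ε ^ 2 = 1 := by rcases hε with rfl | rfl <;> ring
  have hεe : expand ℤ 2 ε = ε := by rcases hε with rfl | rfl <;> simp
  have hεm : ε.map (Int.castRingHom (ZMod 2)) = 1 := by
    rcases hε with rfl | rfl <;> simp [CharTwo.neg_eq]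
  -- The polynomial is `F + 2G` with `F = A X^(8t) + B X^(4t) + C` and `G = ε X^(6t+15) -
  -- X^(2t+12)`. Modulo 2, halving keeps `G(X²)`, the source of the bits 30 and 24 in `oddBits`.
  have hq := cyclotomic_dvd_half_sq_sub_expand hm (q := WA * X ^ (16 * t) + A * B * X ^ (12 * t)
    + (WB + A * C) * X ^ (8 * t) + B * C * X ^ (4 * t) + WC
    + 2 * ((A * X ^ (8 * t) + B * X ^ (4 * t) + C) * (ε * X ^ (6 * t + 15) - X ^ (2 * t + 12))
      + (ε * X ^ (6 * t + 15) - X ^ (2 * t + 12)) ^ 2)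
    - ε * X ^ (12 * t + 30) + X ^ (4 * t + 24)) ?_ h
  · have h1 := map_cyclotomic_dvd h
    have h2 := map_cyclotomic_dvd hq
    simp only [Polynomial.map_add, Polynomial.map_sub, Polynomial.map_mul, Polynomial.map_pow, hA',
      hB', hC', defA, defB, defC, map_signedSum, hεm, Polynomial.map_X, Polynomial.map_ofNat,
      CharTwo.two_eq_zero, CharTwo.sub_eq_add] at h1 h2
    refine dvd_ofBits_elimQuartic (y := X ^ (4 * t)) ?_ ?_
    · convert h1 using 1
      ring
    · convert h2 using 1
      simp only [ofBits_xor, ofBits_clmul, ofBits_shiftLeft, ofBits_one]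
      ring
  · simp only [map_add, map_sub, map_mul, map_pow, expand_X, map_ofNat, hεe]
    generalize expand ℤ 2 A = A2 at *
    generalize expand ℤ 2 B = B2 at *
    generalize expand ℤ 2 C = C2 at *
    linear_combination X ^ (16 * t) * hA + X ^ (8 * t) * hB + hC

theorem totient_le_of_cyclotomic_dvd_ofBits {n f D : ℕ} (h0 : f ≠ 0) (hf : f < 2 ^ (D + 1))
    (h : cyclotomic n (ZMod 2) ∣ ofBits f) : n.totient ≤ D := by
  have h1 := natDegree_le_of_dvd h (mt ofBits_eq_zero_iff.1 h0)
  rw [natDegree_cyclotomic] at h1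
  have h2 := degree_ofBits_lt hf
  have h3 := (natDegree_lt_iff_degree_lt (mt ofBits_eq_zero_iff.1 h0)).2 h2
  omega

theorem cyclotomic_dvd_of_dvd_ofBits_shiftLeft {n f v : ℕ} (hn : 1 < n)
    (h : cyclotomic n (ZMod 2) ∣ ofBits (f <<< v)) : cyclotomic n (ZMod 2) ∣ ofBits f := by
  rw [ofBits_shiftLeft] at h
  have h1 : IsCoprime (cyclotomic n (ZMod 2)) X := by
    simpa using (isCoprime_cyclotomic_X hn).map (mapRingHom (Int.castRingHom (ZMod 2)))
  exact h1.pow_right.dvd_of_dvd_mul_right h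

/-- `D` bounds the degree, hence the totient; `hB` turns this into `m < B`, and `S` collects what
the test cannot exclude. -/
theorem mem_of_cyclotomic_dvd_ofBits {m f D B : ℕ} {S : List ℕ} (h0 : f ≠ 0)
    (hf : f < 2 ^ (D + 1)) (hB : 27 * D ^ 4 < 16 * B ^ 3)
    (hS : ∀ m < B, m % 2 = 1 → m ∈ S ∨ notDvdTest f m = true) (hm : ¬ 2 ∣ m)
    (h : cyclotomic m (ZMod 2) ∣ ofBits f) : m ∈ S := by
  have h1 := totient_le_of_cyclotomic_dvd_ofBits h0 hf h
  have h2 := (totient_bound hm).2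
  have h3 : m < B := by
    by_contra hc
    have := Nat.pow_le_pow_left (not_lt.1 hc) 3
    have := Nat.pow_le_pow_left h1 4
    omega
  exact (hS m h3 (by omega)).resolve_right fun h4 => not_cyclotomic_dvd_ofBits (by omega) h4 h

/-! ### The polynomial `T_t`, its reflection and its even and odd parts -/

/-- The coefficient of `X ^ (8 * t)`. -/
def coeffsA : List (Bool × ℕ) :=
  [(false, 27), (false, 26), (false, 25), (false, 22), (false, 20), (false, 18), (false, 17),
    (true, 16), (true, 15)]

/-- The coefficient of `X ^ (4 * t)`. -/
def coeffsB : List (Bool × ℕ) :=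
  [(true, 26), (true, 25), (false, 23), (true, 21), (true, 20), (false, 19), (true, 18), (true, 17),
    (false, 14), (false, 14), (false, 14), (true, 13), (true, 13), (true, 13), (false, 10),
    (false, 9), (true, 8), (false, 7), (false, 6), (true, 4), (false, 2), (false, 1)]

/-- The coefficient of `X ^ 0`, i.e. the part not involving `t`. -/
def coeffsC : List (Bool × ℕ) :=
  [(false, 12), (false, 11), (true, 10), (true, 9), (true, 7), (true, 5), (true, 2), (true, 1),
    (true, 0)]

/-- The substitution `X ↦ -X`. -/
def flipSigns (L : List (Bool × ℕ)) : List (Bool × ℕ) :=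
  L.map fun p => (p.1 ^^ (p.2 % 2 == 1), p.2)

theorem signedSum_flipSigns (L : List (Bool × ℕ)) :
    signedSum (flipSigns L) = (signedSum L).comp (-X) := by
  induction L with
  | nil => simp [signedSum, flipSigns]
  | cons p L ih =>
    obtain ⟨s, e⟩ := p
    have h : signedMonomial (s ^^ (e % 2 == 1), e) = (signedMonomial (s, e)).comp (-X) := by
      rcases Nat.even_or_odd e with he | he
      · cases s <;> simp [signedMonomial, he.neg_pow, Nat.even_iff.1 he]
      · cases s <;> simp [signedMonomial, he.neg_pow, Nat.odd_iff.1 he]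
    rw [signedSum_cons, add_comp, ← ih, ← h, ← signedSum_cons]
    rfl

/-- The terms of even degree, as a polynomial in `X ^ 2`. -/
def evenPart (L : List (Bool × ℕ)) : List (Bool × ℕ) :=
  (L.filter fun p => p.2 % 2 == 0).map fun p => (p.1, p.2 / 2)

/-- The terms of odd degree, divided by `X`, as a polynomial in `X ^ 2`. -/
def oddPart (L : List (Bool × ℕ)) : List (Bool × ℕ) :=
  (L.filter fun p => p.2 % 2 == 1).map fun p => (p.1, p.2 / 2)

theorem expand_evenPart_add (L : List (Bool × ℕ)) :
    expand ℤ 2 (signedSum (evenPart L)) + X * expand ℤ 2 (signedSum (oddPart L)) = signedSum L := by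
  induction L with
  | nil => simp [signedSum, evenPart, oddPart]
  | cons p L ih =>
    obtain ⟨s, e⟩ := p
    rw [signedSum_cons, ← ih]
    rcases Nat.even_or_odd e with he | he
    · have h1 : evenPart ((s, e) :: L) = (s, e / 2) :: evenPart L := by
        simp [evenPart, Nat.even_iff.1 he]
      have h2 : oddPart ((s, e) :: L) = oddPart L := by simp [oddPart, Nat.even_iff.1 he]
      rw [h1, h2, signedSum_cons, map_add]
      obtain ⟨k, rfl⟩ := he
      have h3 : (k + k) / 2 = k := by omega
      cases s <;> simp [signedMonomial, h3] <;> ring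
    · have h1 : oddPart ((s, e) :: L) = (s, e / 2) :: oddPart L := by
        simp [oddPart, Nat.odd_iff.1 he]
      have h2 : evenPart ((s, e) :: L) = evenPart L := by simp [evenPart, Nat.odd_iff.1 he]
      rw [h1, h2, signedSum_cons, map_add]
      obtain ⟨k, rfl⟩ := he
      have h3 : (2 * k + 1) / 2 = k := by omega
      cases s <;> simp [signedMonomial, h3] <;> ring

/-- `polyT t` with integer coefficients, grouped by powers of `X ^ t`. -/
noncomputable def intPolyT (t : ℕ) : ℤ[X] :=
  signedSum coeffsA * X ^ (8 * t) + 1 * 2 * X ^ (6 * t + 15) + signedSum coeffsB * X ^ (4 * t)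
    - 2 * X ^ (2 * t + 12) + signedSum coeffsC

theorem map_intPolyT (t : ℕ) : (intPolyT t).map (Int.castRingHom ℚ) = polyT t := by
  simp only [intPolyT, polyT, signedSum, signedMonomial, coeffsA, coeffsB, coeffsC, List.map_cons,
    List.map_nil, List.sum_cons, List.sum_nil, if_true, Bool.false_eq_true, if_false,
    Polynomial.map_add, Polynomial.map_sub, Polynomial.map_mul, Polynomial.map_pow,
    Polynomial.map_neg, Polynomial.map_X, Polynomial.map_ofNat, Polynomial.map_one,
    Polynomial.map_zero]
  ring

theorem cyclotomic_dvd_intPolyT {t b : ℕ} (h : cyclotomic b ℚ ∣ polyT t) :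
    cyclotomic b ℤ ∣ intPolyT t := by
  rw [← map_intPolyT, ← map_cyclotomic_int] at h
  exact (map_dvd_map _ (RingHom.injective_int _) (cyclotomic.monic b ℤ)).1 h

theorem intPolyT_comp_neg_X (t : ℕ) : (intPolyT t).comp (-X) =
    signedSum (flipSigns coeffsA) * X ^ (8 * t) + -1 * 2 * X ^ (6 * t + 15)
      + signedSum (flipSigns coeffsB) * X ^ (4 * t) - 2 * X ^ (2 * t + 12)
      + signedSum (flipSigns coeffsC) := by
  have h8 : Even (8 * t) := ⟨4 * t, by ring⟩
  have h4 : Even (4 * t) := ⟨2 * t, by ring⟩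
  have h2 : Even (2 * t + 12) := ⟨t + 6, by ring⟩
  have h6 : Odd (6 * t + 15) := ⟨3 * t + 7, by ring⟩
  simp only [signedSum_flipSigns, intPolyT, add_comp, sub_comp, mul_comp, pow_comp, X_comp,
    one_comp, ofNat_comp, h8.neg_pow, h4.neg_pow, h2.neg_pow, h6.neg_pow]
  ring

theorem intPolyT_eq_expand (t : ℕ) : intPolyT t =
    expand ℤ 2 (signedSum (evenPart coeffsA) * X ^ (4 * t) + signedSum (evenPart coeffsB) * X ^ (2 * t)
        - 2 * X ^ (t + 6) + signedSum (evenPart coeffsC))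
      + X * expand ℤ 2 (signedSum (oddPart coeffsA) * X ^ (4 * t) + 2 * X ^ (3 * t + 7)
        + signedSum (oddPart coeffsB) * X ^ (2 * t) + signedSum (oddPart coeffsC)) := by
  rw [intPolyT, ← expand_evenPart_add coeffsA, ← expand_evenPart_add coeffsB,
    ← expand_evenPart_add coeffsC]
  simp only [map_add, map_sub, map_mul, map_pow, expand_X, map_ofNat]
  ring

/-! ### Exclusion of a single `b` by evaluation at 4 -/

/-- Value at 4 of `signedSum L`. -/
def signedEval (L : List (Bool × ℕ)) : ℤ :=
  L.foldr (fun p n => (if p.1 then -((4 ^ p.2 : ℕ) : ℤ) else ((4 ^ p.2 : ℕ) : ℤ)) + n) 0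

/-- Value of `intPolyT t` at 4, in terms of `w = 4 ^ t`. -/
def evalT (w : ℤ) : ℤ :=
  signedEval coeffsA * (w * w * w * w * w * w * w * w) + 2 * 4 ^ 15 * (w * w * w * w * w * w)
    + signedEval coeffsB * (w * w * w * w) - 2 * 4 ^ 12 * (w * w) + signedEval coeffsC

/-- Product of `4 ^ e - 1` over the divisors `e ≤ k` of `b`. -/
def evalDivisors (b : ℕ) : ℕ → ℕ
  | 0 => 1
  | k + 1 => evalDivisors b k * (if b % (k + 1) = 0 then 4 ^ (k + 1) - 1 else 1)

theorem eval_signedSum (L : List (Bool × ℕ)) : (signedSum L).eval 4 = signedEval L := by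
  induction L with
  | nil => simp [signedSum, signedEval]
  | cons p L ih =>
    rw [signedSum_cons, eval_add, ih]
    obtain ⟨s, e⟩ := p
    cases s <;> simp [signedMonomial, signedEval]

theorem eval_intPolyT (t : ℕ) : (intPolyT t).eval 4 = evalT (4 ^ t) := by
  simp only [intPolyT, evalT, eval_add, eval_sub, eval_mul, eval_pow, eval_X, eval_one, eval_ofNat,
    eval_signedSum]
  ring

theorem evalDivisors_eq (b k : ℕ) : (evalDivisors b k : ℤ) =
    (∏ e ∈ (Finset.range k).filter (fun e => b % (e + 1) = 0), (X ^ (e + 1) - 1 : ℤ[X])).eval 4 := by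
  induction k with
  | zero => simp [evalDivisors]
  | succ k ih =>
    rw [evalDivisors, Finset.range_add_one, Finset.filter_insert]
    split_ifs with h
    · rw [Finset.prod_insert (by simp), eval_mul, ← ih]
      push_cast [Nat.one_le_pow]
      simp
      ring
    · rw [← ih]; simp

theorem not_cyclotomic_dvd_intPolyT {b t : ℕ} (hb : 0 < b)
    (h : ∀ s < b, ¬ ((4 ^ b - 1 : ℕ) : ℤ) ∣ evalT ((4 ^ s : ℕ) : ℤ) * evalDivisors b (b / 2)) :
    ¬ cyclotomic b ℤ ∣ intPolyT t := by
  intro hd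
  have h1 := (X_pow_sub_one_dvd_cyclotomic_mul_prod hb ℤ).trans (mul_dvd_mul_right hd _)
  have h2 := eval_dvd (x := 4) h1
  rw [prod_properDivisors_eq hb, eval_mul, ← evalDivisors_eq, eval_intPolyT] at h2
  have hM : ((4 ^ b - 1 : ℕ) : ℤ) = 4 ^ b - 1 := by
    push_cast [Nat.one_le_pow]; rfl
  -- As `4 ^ b ≡ 1`, finitely many residues of `t` cover all `t`.
  have h3 : (4 : ℤ) ^ t ≡ 4 ^ (t % b) [ZMOD 4 ^ b - 1] := by
    have h4 : (4 : ℤ) ^ b ≡ 1 [ZMOD 4 ^ b - 1] := (Int.modEq_iff_dvd.2 dvd_rfl).symm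
    conv_lhs => rw [← Nat.div_add_mod t b, pow_add, pow_mul]
    simpa using (h4.pow (t / b)).mul_right (4 ^ (t % b))
  have h5 : evalT (4 ^ t) ≡ evalT (4 ^ (t % b)) [ZMOD 4 ^ b - 1] := by
    unfold evalT; gcongr
  refine h (t % b) (Nat.mod_lt _ hb) ?_
  rw [hM]
  push_cast
  have h6 := (h5.mul_right (evalDivisors b (b / 2) : ℤ)).dvd
  simp only [eval_sub, eval_pow, eval_X, eval_one] at h2
  simpa using dvd_add h6 h2

/-! ### The three cases and the conclusion -/

theorem mem_of_odd {m t : ℕ} (h1 : 1 < m) (hm : ¬ 2 ∣ m) (h : cyclotomic m ℤ ∣ intPolyT t) :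
    m ∈ [1, 3, 15] := by
  have h2 := cyclotomic_dvd_oddBits hm _ _ _ (Or.inl rfl) h
  have h3 : oddBits coeffsA coeffsB coeffsC =
      142863153453290388913988699510732554202084426071716805 <<< 83 := by decide +kernel
  rw [h3] at h2
  -- 176 is the degree of the eliminant once its factor `X ^ 83` is removed.
  exact mem_of_cyclotomic_dvd_ofBits (D := 176) (B := 1210) (by norm_num) (by norm_num)
    (by norm_num) (by decide +kernel) hm (cyclotomic_dvd_of_dvd_ofBits_shiftLeft h1 h2)

theorem mem_of_two_mul_odd {m t : ℕ} (h1 : 1 < m) (hm : ¬ 2 ∣ m)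
    (h : cyclotomic (2 * m) ℤ ∣ intPolyT t) : m ∈ [1, 3, 7] := by
  have h0 := cyclotomic_dvd_comp_neg_X hm h
  rw [intPolyT_comp_neg_X] at h0
  have h2 := cyclotomic_dvd_oddBits hm _ _ _ (Or.inr rfl) h0
  have h3 : oddBits (flipSigns coeffsA) (flipSigns coeffsB) (flipSigns coeffsC) =
      1540598995520014434466857651000980539251326540267156377 <<< 81 := by decide +kernel
  rw [h3] at h2
  -- 1210 is the least `B` with `27 * 180 ^ 4 < 16 * B ^ 3`.
  exact mem_of_cyclotomic_dvd_ofBits (D := 180) (B := 1210) (by norm_num) (by norm_num)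
    (by norm_num) (by decide +kernel) hm (cyclotomic_dvd_of_dvd_ofBits_shiftLeft h1 h2)

theorem cyclotomic_dvd_evenBits {n t : ℕ} (LA LB LC LA' LB' LC' : List (Bool × ℕ))
    (hE : cyclotomic n ℤ ∣ signedSum LA * X ^ (4 * t) + signedSum LB * X ^ (2 * t)
      - 2 * X ^ (t + 6) + signedSum LC)
    (hO : cyclotomic n ℤ ∣ signedSum LA' * X ^ (4 * t) + 2 * X ^ (3 * t + 7)
      + signedSum LB' * X ^ (2 * t) + signedSum LC') :
    cyclotomic n (ZMod 2) ∣ ofBits (elimQuadratic (sumBits LA) (sumBits LB) (sumBits LC)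
      (sumBits LA') (sumBits LB') (sumBits LC')) := by
  have hE' := map_cyclotomic_dvd hE
  have hO' := map_cyclotomic_dvd hO
  simp only [Polynomial.map_add, Polynomial.map_sub, Polynomial.map_mul, Polynomial.map_pow,
    map_signedSum, Polynomial.map_X, Polynomial.map_ofNat, CharTwo.two_eq_zero, zero_mul, sub_zero,
    add_zero, show 4 * t = 2 * t * 2 by ring, pow_mul _ (2 * t) 2] at hE' hO'
  exact dvd_ofBits_elimQuadratic hE' hO'

theorem mem_of_four_dvd {j m t : ℕ} (hm : ¬ 2 ∣ m)
    (h : cyclotomic (2 ^ (j + 2) * m) ℤ ∣ intPolyT t) :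
    m ∈ [1, 15] ∧ 2 ^ j * m.totient ≤ 34 := by
  have hm0 : 0 < m := by omega
  have hp : 1 < 2 ^ (j + 1) := Nat.one_lt_two_pow (by omega)
  have hn : 1 < 2 ^ (j + 1) * m := hp.trans_le (Nat.le_mul_of_pos_right _ hm0)
  rw [intPolyT_eq_expand, show 2 ^ (j + 2) * m = 2 ^ (j + 1) * m * 2 by ring] at h
  obtain ⟨hE, hO⟩ := cyclotomic_dvd_of_two_dvd (by omega)
    ((dvd_pow_self 2 (by omega)).mul_right m) h
  have h2 := cyclotomic_dvd_evenBits _ _ _ _ _ _ hE hO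
  have h3 : elimQuadratic (sumBits (evenPart coeffsA)) (sumBits (evenPart coeffsB))
      (sumBits (evenPart coeffsC)) (sumBits (oddPart coeffsA)) (sumBits (oddPart coeffsB))
      (sumBits (oddPart coeffsC)) = 31261546263 <<< 9 := by decide +kernel
  rw [h3] at h2
  have h4 := cyclotomic_dvd_of_dvd_ofBits_shiftLeft hn h2
  have h5 := totient_le_of_cyclotomic_dvd_ofBits (D := 34) (by norm_num) (by norm_num) h4
  rw [Nat.totient_mul (((Nat.Prime.coprime_iff_not_dvd Nat.prime_two).2 hm).pow_left _),
    Nat.totient_prime_pow_succ Nat.prime_two, Nat.add_one_sub_one, mul_one] at h5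
  refine ⟨mem_of_cyclotomic_dvd_ofBits (D := 34) (B := 132) (f := 31261546263) (by norm_num)
    (by norm_num) (by norm_num) (by decide +kernel) hm (dvd_trans ?_ h4), h5⟩
  -- In characteristic 2, `Φ_{2^(j+1) m}` is a positive power of `Φ_m`, so the test need only run
  -- over odd `m`.
  rw [cyclotomic_mul_prime_pow_eq (ZMod 2) hm (Nat.succ_pos j)]
  refine dvd_pow_self _ (Nat.sub_ne_zero_of_lt ?_)
  exact Nat.pow_lt_pow_right (by norm_num) (by omega)

theorem not_dvd_of_mem {b t : ℕ} (hb : b ∈ [3, 15, 6, 14, 4, 8, 16, 32, 64, 128, 60, 120, 240]) :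
    ¬ cyclotomic b ℤ ∣ intPolyT t := by
  have key : ∀ b ∈ [3, 15, 6, 14, 4, 8, 16, 32, 64, 128, 60, 120, 240], 0 < b ∧
      ∀ s < b, ¬ ((4 ^ b - 1 : ℕ) : ℤ) ∣ evalT ((4 ^ s : ℕ) : ℤ) * evalDivisors b (b / 2) := by
    decide +kernel
  exact not_cyclotomic_dvd_intPolyT (key b hb).1 (key b hb).2

theorem mainTheorem11 (t b : ℕ) (hb : 3 ≤ b) :
    ¬ (cyclotomic b ℚ ∣ polyT t) := by
  intro h
  have hd := cyclotomic_dvd_intPolyT h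
  obtain ⟨k, m, hm, rfl⟩ := Nat.exists_eq_two_pow_mul_odd (n := b) (by omega)
  have hm2 : ¬ 2 ∣ m := by rwa [← even_iff_two_dvd, Nat.not_even_iff_odd]
  refine not_dvd_of_mem ?_ hd
  match k with
  | 0 =>
    rw [pow_zero, one_mul] at hd hb ⊢
    have := mem_of_odd (by omega) hm2 hd
    simp only [List.mem_cons, List.not_mem_nil, or_false] at this ⊢
    omega
  | 1 =>
    rw [pow_one] at hd hb ⊢
    have := mem_of_two_mul_odd (by omega) hm2 hd
    simp only [List.mem_cons, List.not_mem_nil, or_false] at this ⊢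
    omega
  | j + 2 =>
    obtain ⟨h1, h2⟩ := mem_of_four_dvd hm2 hd
    -- Already `2 ^ 6` exceeds 34.
    have hj : j < 6 := by
      by_contra hc
      have h3 := Nat.pow_le_pow_right two_pos (not_lt.1 hc)
      have h4 := Nat.totient_pos.2 hm.pos
      nlinarith
    have h15 : Nat.totient 15 = 8 := by decide
    simp only [List.mem_cons, List.not_mem_nil, or_false] at h1
    rcases h1 with rfl | rfl
    · interval_cases j <;> decide
    · rw [h15] at h2
      interval_cases j <;> first | decide | omega
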